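/- Let $\mathcal M=(\mathcal S,\mathcal A,P,r,H,\rho)$ be an episodic MDP with finite state space $\mathcal S$, finite action space $\mathcal A$, horizon $H$, transition probabilities $P_h(\cdot\mid s,a)$ ($h\in[H]=\{1,\dots,H\}$), rewards $r_h:\mathcal S\times\mathcal A\to[0,1]$ and initial distribution $\rho$. Let $\Pi$ be the set of non-stationary stochastic policies $\pi=(\pi_1,\dots,\pi_H)$, $\pi_h:\mathcal S\to\Delta(\mathcal A)$, and let $d^\pi_h(s,a)$ be the probability that $(s_h,a_h)=(s,a)$ under $\pi$ in $\mathcal M$. Let $\mathcal D$ be a dataset of $N\ge 1$ expert trajectories $(s_1,a_1,\dots,s_H,a_H)$, and let $\widehat{d^{\pi^{\mathrm E}}_h}(s,a)$ be the fraction of trajectories in $\mathcal D$ with $(s_h,a_h)=(s,a)$. The claim is deterministic and holds for every such dataset, whatever the expert. A policy $\bar\pi$ is an $\varepsilon$-optimal solution of TV-AIL if $$\sum_{h=1}^H\big\|d^{\bar\pi}_h-\widehat{d^{\pi^{\mathrm E}}_h}\big\|_1\le\min_{\pi\in\Pi}\sum_{h=1}^H\big\|d^{\pi}_h-\widehat{d^{\pi^{\mathrm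 E}}_h}\big\|_1+\varepsilon .$$ Let $\mathcal C_{\mathrm{TV}}$ be the set of families $c=(c_h)_{h\in[H]}$ of functions $c_h:\mathcal S\times\mathcal A\to[-1,1]$, and let $\mathcal P_{\mathcal C_{\mathrm{TV}}}$ be the Euclidean projection onto it. The gradient-based TV-AIL algorithm with $T$ iterations, step sizes $\eta^{(t)}$, optimization error $\varepsilon_{\mathrm{opt}}$ and an arbitrary initialization $c^{(1)}\in\mathcal C_{\mathrm{TV}}$ does the following for $t=1,\dots,T$: 1. it chooses any policy $\pi^{(t)}$ that is optimal in $\mathcal M$ for the reward function $-c^{(t)}$ up to an error $\varepsilon_{\mathrm{opt}}$ in policy value (the expected total reward over the $H$ steps); 2. it sets $c^{(t+1)}=\mathcal P_{\mathcal C_{\mathrm{TV}}}\big(c^{(t)}-\eta^{(t)}\nabla f^{(t)}(c^{(t)})\big)$, where $f^{(t)}(c)=\sum_{h=1}^H\sum_{(s,a)}c_h(s,a)\big(\widehat{d^{\pi^{\mathrm E}}_h}(s,a)-d^{\pi^{(t)}}_h(s,a)\big)$. With $\bar d_h(s,a)=\frac1T\sum_{t=1}^T d^{\pi^{(t)}}_h(s,a)$,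 it outputs a policy $\bar\pi$ with $\bar\pi_h(a\mid s)=\bar d_h(s,a)/\sum_{a'}\bar d_h(s,a')$ whenever the denominator is nonzero, and with $\bar\pi_h(\cdot\mid s)$ an arbitrary distribution otherwise. **Proposition.** There is a universal constant $C>0$ such that the following holds for all such $\mathcal M$ and $\mathcal D$ and every $\varepsilon\in(0,H)$. If $\varepsilon_{\mathrm{opt}}\le\varepsilon/2$, $T\ge C\,|\mathcal S||\mathcal A|H^2/\varepsilon^2$ and $\eta^{(t)}=\sqrt{|\mathcal S||\mathcal A|/(8T)}$ for all $t$, then every output $\bar\pi$ of the algorithm is an $\varepsilon$-optimal solution of TV-AIL. -/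

import Mathlib

namespace TVAIL

/-- A tabular episodic MDP with states `S`, actions `A` and horizon `H`. Time steps `1, …, H` are
indexed by `Fin H` (so from `0` to `H - 1`). -/
structure MDP (H : ℕ) (S A : Type*) [Fintype S] where
  /-- initial state distribution `ρ` -/
  init : stdSimplex ℝ S
  /-- `trans h s a` is the distribution `P_h(· | s, a)` of the next state -/
  trans : Fin H → S → A → stdSimplex ℝ S
  /-- reward function `r_h(s, a)` of the MDP -/
  reward : Fin H → S → A → ℝ
  reward_mem : ∀ h s a, reward h s a ∈ Set.Icc (0 : ℝ) 1

/-- Non-stationary stochastic policies: `π h s` is the distribution `π_h(· | s)` on actions. -/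
abbrev Policy (H : ℕ) (S A : Type*) [Fintype A] := Fin H → S → stdSimplex ℝ A

/-- Trajectories `(s_1, a_1, …, s_H, a_H)`. -/
abbrev Traj (H : ℕ) (S A : Type*) := Fin H → S × A

/-- Functions `c_h(s, a)`, as a Euclidean space indexed by `(h, s, a)`. -/
abbrev Cost (H : ℕ) (S A : Type*) [Fintype S] [Fintype A] := EuclideanSpace ℝ (Fin H × S × A)

section

variable {H N : ℕ} {S A : Type*} [Fintype S] [Fintype A]

/-- The probability with which the state of `τ` at step `h` is generated given the preceding
state-action pair: `ρ(s_1)` at the first step, and `P_{h-1}(s_h | s_{h-1}, a_{h-1})` afterwards. -/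
noncomputable def MDP.stateProb (M : MDP H S A) (τ : Traj H S A) (h : Fin H) : ℝ :=
  if h.val = 0 then M.init.1 (τ h).1
  else
    let k : Fin H := ⟨h.val - 1, lt_of_le_of_lt (Nat.sub_le _ _) h.isLt⟩
    (M.trans k (τ k).1 (τ k).2).1 (τ h).1

/-- The probability of the trajectory `τ` when the policy `π` is run in `M`. -/
noncomputable def MDP.trajProb (M : MDP H S A) (π : Policy H S A) (τ : Traj H S A) : ℝ :=
  ∏ h : Fin H, M.stateProb τ h * (π h (τ h).1).1 (τ h).2

/-- The policy value: expected total reward of `π` for the reward function `r`. -/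
noncomputable def MDP.value (M : MDP H S A) (r : Fin H → S → A → ℝ) (π : Policy H S A) : ℝ :=
  ∑ τ : Traj H S A, M.trajProb π τ * ∑ h : Fin H, r h (τ h).1 (τ h).2

/-- `π` is an optimal policy for the reward function `r`, up to an error of `δ`. -/
def MDP.IsApproxOptimalPolicy (M : MDP H S A) (r : Fin H → S → A → ℝ) (δ : ℝ)
    (π : Policy H S A) : Prop :=
  ∀ π' : Policy H S A, M.value r π' ≤ M.value r π + δ

variable [DecidableEq S] [DecidableEq A]

/-- The state-action distribution `d^π_h(s, a)`: the probability that `(s_h, a_h) = (s, a)`. -/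
noncomputable def MDP.occ (M : MDP H S A) (π : Policy H S A) (h : Fin H) (s : S) (a : A) : ℝ :=
  ∑ τ : Traj H S A with τ h = (s, a), M.trajProb π τ

/-- The empirical state-action distribution of a dataset of `N` trajectories: the fraction of the
trajectories that are at `(s, a)` in time step `h`. -/
noncomputable def empOcc (D : Fin N → Traj H S A) (h : Fin H) (s : S) (a : A) : ℝ :=
  ((Finset.univ.filter fun i : Fin N => D i h = (s, a)).card : ℝ) / (N : ℝ)

/-- The TV-AIL objective `∑_h ‖d^π_h - d̂_h‖₁`. -/
noncomputable def MDP.tvLoss (M : MDP H S A) (D : Fin N → Traj H S A) (π : Policy H S A) : ℝ :=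
  ∑ h : Fin H, ∑ s : S, ∑ a : A, |M.occ π h s a - empOcc D h s a|

/-- `π` is an `ε`-optimal solution of TV-AIL: its loss is at most the minimum of the loss over all
policies, plus `ε`. -/
def MDP.IsEpsOptimalTVAIL (M : MDP H S A) (D : Fin N → Traj H S A) (ε : ℝ)
    (π : Policy H S A) : Prop :=
  ∃ m : ℝ, IsLeast (Set.range (M.tvLoss D)) m ∧ M.tvLoss D π ≤ m + ε

/-- The set `C_TV` of discriminators, with values in `[-1, 1]`. -/
def discriminators (H : ℕ) (S A : Type*) [Fintype S] [Fintype A] : Set (Cost H S A) := {c | ∀ i, c i ∈ Set.Icc (-1 : ℝ) 1}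

/-- `z` is a Euclidean projection of `x` on the set `K`. -/
def IsProjection {E : Type*} [NormedAddCommGroup E] (K : Set E) (x z : E) : Prop :=
  z ∈ K ∧ ∀ w ∈ K, ‖z - x‖ ≤ ‖w - x‖

/-- The discriminator objective for the policy `π`:
`f(c) = ∑_h ∑_{(s,a)} c_h(s, a) (d̂_h(s, a) - d^π_h(s, a))`. -/
noncomputable def MDP.discObj (M : MDP H S A) (D : Fin N → Traj H S A) (π : Policy H S A)
    (c : Cost H S A) : ℝ :=
  ∑ h : Fin H, ∑ s : S, ∑ a : A, c (h, s, a) * (empOcc D h s a - M.occ π h s a)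

/-- The mean of the state-action distributions of the policies `π 1, …, π T`. -/
noncomputable def MDP.meanOcc (M : MDP H S A) (T : ℕ) (π : ℕ → Policy H S A)
    (h : Fin H) (s : S) (a : A) : ℝ :=
  (∑ t ∈ Finset.Icc 1 T, M.occ (π t) h s a) / (T : ℝ)

/-- `c` (discriminators), `π` (policies) and `out` (output policy) form a run of the gradient-based
TV-AIL algorithm on the dataset `D` with `T` iterations, step sizes `η` and policy optimization
error `εopt`. The initialization `c 1` is any discriminator. -/
structure MDP.IsTVAILRun (M : MDP H S A) (D : Fin N → Traj H S A) (T : ℕ) (η : ℕ → ℝ) (εopt : ℝ)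
    (c : ℕ → Cost H S A) (π : ℕ → Policy H S A) (out : Policy H S A) : Prop where
  init_mem : c 1 ∈ discriminators H S A
  policy_step : ∀ t ∈ Finset.Icc 1 T,
    M.IsApproxOptimalPolicy (fun h s a => -(c t (h, s, a))) εopt (π t)
  disc_step : ∀ t ∈ Finset.Icc 1 T,
    IsProjection (discriminators H S A)
      (c t - η t • gradient (M.discObj D (π t)) (c t)) (c (t + 1))
  /-- The output is the conditional distribution of the mean state-action distribution. It is
  arbitrary at states of mean probability `0`, where the quotient is undefined. -/
  output : ∀ h s a, (∑ a' : A, M.meanOcc T π h s a') ≠ 0 →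
    (out h s).1 a = M.meanOcc T π h s a / ∑ a' : A, M.meanOcc T π h s a'

end

end TVAIL

/-! TV-AIL is a zero-sum game between the policy and the discriminator, by the duality between the
ℓ¹ norm and the cube `[-1, 1]`. The discriminator plays projected online gradient descent and the
policy plays approximate best responses, so the average play is nearly a minimax solution. Let `f t`
be the objective of `π t`. The sign of mean minus empirical distribution gives a discriminator `w`
with `-∑ f t w` equal to `T` times the loss of the mean distribution
(`exists_discriminator_meanOcc`). The regret bound `sum_inner_sub_le_of_isProjection` replaces `w`
by the iterates `c t`. The best response property then compares `-f t (c t)` with any fixed policy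
`π'`, whose value against a discriminator is at most its loss (`neg_discObj_le_tvLoss`). The loss of
the mean is the loss of the output, because the Bellman flow equation is linear in the occupancies
(`occ_eq_meanOcc`). -/

open Finset

namespace TVAIL

/-! ### Marginals of finite inhomogeneous Markov chains. -/

section MarkovChain

variable {X : Type*} [Fintype X]

/-- The weight of a path of a Markov chain with initial weights `p` and kernels `K`. -/
def pathWeight {n : ℕ} (p : X → ℝ) (K : Fin n → X → X → ℝ) (τ : Fin (n + 1) → X) : ℝ :=
  p (τ 0) * ∏ i : Fin n, K i (τ i.castSucc) (τ i.succ)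

theorem sum_fin_cons {n : ℕ} (f : (Fin (n + 1) → X) → ℝ) :
    ∑ τ, f τ = ∑ τ : Fin n → X, ∑ x, f (Fin.cons x τ) := by
  rw [← (Fin.consEquiv fun _ : Fin (n + 1) => X).sum_comp, Fintype.sum_prod_type, sum_comm]
  rfl

/-- Summing out the first point of a path gives a path of the shifted chain. -/
theorem sum_pathWeight_cons {n : ℕ} (p : X → ℝ) (K : Fin (n + 1) → X → X → ℝ)
    (τ : Fin (n + 1) → X) :
    ∑ x, pathWeight p K (Fin.cons x τ) =
      pathWeight (fun y => ∑ x, p x * K 0 x y) (fun i => K i.succ) τ := by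
  simp only [pathWeight, Fin.prod_univ_succ, sum_mul]
  refine sum_congr rfl fun x _ => ?_
  simp only [Fin.cons_zero, Fin.cons_succ, Fin.castSucc_zero, ← Fin.succ_castSucc]
  ring

theorem sum_pathWeight {n : ℕ} (p : X → ℝ) (K : Fin n → X → X → ℝ)
    (hK : ∀ i x, ∑ y, K i x y = 1) : ∑ τ, pathWeight p K τ = ∑ x, p x := by
  induction n generalizing p with
  | zero =>
    rw [sum_fin_cons]
    simp [pathWeight]
  | succ n ih =>
    rw [sum_fin_cons]
    simp_rw [sum_pathWeight_cons]
    rw [ih _ _ fun i x => hK _ _, sum_comm]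
    simp_rw [← mul_sum, hK, mul_one]

/-- The factor `F` is absorbed into the initial weights, which need not be nonnegative or sum to
one. -/
theorem sum_pathWeight_mul_zero {n : ℕ} (p : X → ℝ) (K : Fin n → X → X → ℝ)
    (hK : ∀ i x, ∑ y, K i x y = 1) (F : X → ℝ) :
    ∑ τ, pathWeight p K τ * F (τ 0) = ∑ x, p x * F x := by
  rw [← sum_pathWeight (fun x => p x * F x) K hK]
  refine sum_congr rfl fun τ _ => ?_
  simp only [pathWeight]
  ring

/-- The Markov property, for the marginals of two consecutive points of the path. -/
theorem sum_pathWeight_mul_succ {n : ℕ} (p : X → ℝ) (K : Fin n → X → X → ℝ)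
    (hK : ∀ i x, ∑ y, K i x y = 1) (i : Fin n) (F : X → ℝ) :
    ∑ τ, pathWeight p K τ * F (τ i.succ) =
      ∑ τ, pathWeight p K τ * ∑ y, K i (τ i.castSucc) y * F y := by
  induction n generalizing p with
  | zero => exact i.elim0
  | succ n ih =>
    rw [sum_fin_cons]
    simp_rw [Fin.cons_succ, ← sum_mul, sum_pathWeight_cons]
    induction i using Fin.cases with
    | zero =>
      rw [sum_pathWeight_mul_zero _ _ (fun i x => hK _ _)]
      simp only [Fin.castSucc_zero]
      rw [sum_pathWeight_mul_zero _ _ hK fun x => ∑ y, K 0 x y * F y]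
      simp_rw [sum_mul, mul_sum]
      rw [sum_comm]
      simp_rw [mul_assoc]
    | succ i =>
      rw [ih _ _ (fun i x => hK _ _)]
      conv_rhs => rw [sum_fin_cons]
      simp_rw [← Fin.succ_castSucc, Fin.cons_succ, ← sum_mul, sum_pathWeight_cons]

end MarkovChain

/-! ### Occupancy measures and the Bellman flow equation. -/

section Occupancy

variable {S A : Type*} [Fintype S] [Fintype A]

theorem MDP.trajProb_nonneg {H : ℕ} (M : MDP H S A) (π : Policy H S A) (τ : Traj H S A) :
    0 ≤ M.trajProb π τ := by
  refine prod_nonneg fun h _ => mul_nonneg ?_ ((π h _).2.1 _)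
  unfold MDP.stateProb
  split_ifs
  · exact M.init.2.1 _
  · exact (M.trans _ _ _).2.1 _

/-- The joint kernel of the next state and action under the policy `π`. -/
noncomputable def MDP.kernel {n : ℕ} (M : MDP (n + 1) S A) (π : Policy (n + 1) S A) (i : Fin n)
    (x y : S × A) : ℝ :=
  (M.trans i.castSucc x.1 x.2).1 y.1 * (π i.succ y.1).1 y.2

theorem MDP.sum_kernel {n : ℕ} (M : MDP (n + 1) S A) (π : Policy (n + 1) S A) (i : Fin n)
    (x : S × A) : ∑ y, M.kernel π i x y = 1 := by
  simp only [MDP.kernel, Fintype.sum_prod_type, ← mul_sum, (π _ _).2.2, mul_one,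
    (M.trans _ _ _).2.2]

theorem MDP.trajProb_eq_pathWeight {n : ℕ} (M : MDP (n + 1) S A) (π : Policy (n + 1) S A)
    (τ : Traj (n + 1) S A) :
    M.trajProb π τ =
      pathWeight (fun x : S × A => M.init.1 x.1 * (π 0 x.1).1 x.2) (M.kernel π) τ := by
  rw [MDP.trajProb, pathWeight, Fin.prod_univ_succ]
  -- Both factors agree by unfolding: the test `h.val = 0` evaluates at `0` and at `i.succ`, and the
  -- predecessor of `i.succ` is `i.castSucc`.
  congr 1

theorem MDP.sum_trajProb {n : ℕ} (M : MDP (n + 1) S A) (π : Policy (n + 1) S A) :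
    ∑ τ, M.trajProb π τ = 1 := by
  simp_rw [M.trajProb_eq_pathWeight]
  rw [sum_pathWeight _ _ (M.sum_kernel π)]
  simp only [Fintype.sum_prod_type, ← mul_sum, (π _ _).2.2, mul_one, M.init.2.2]

variable [DecidableEq S] [DecidableEq A]

theorem MDP.occ_nonneg {H : ℕ} (M : MDP H S A) (π : Policy H S A) (h : Fin H) (s : S) (a : A) :
    0 ≤ M.occ π h s a :=
  sum_nonneg fun _ _ => M.trajProb_nonneg π _

theorem MDP.sum_trajProb_mul {H : ℕ} (M : MDP H S A) (π : Policy H S A) (h : Fin H)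
    (F : S × A → ℝ) :
    ∑ τ, M.trajProb π τ * F (τ h) = ∑ x : S × A, M.occ π h x.1 x.2 * F x := by
  rw [← sum_fiberwise univ fun τ : Traj H S A => τ h]
  refine sum_congr rfl fun x _ => ?_
  rw [MDP.occ, sum_mul]
  refine sum_congr rfl fun τ hτ => ?_
  rw [(mem_filter.1 hτ).2]

theorem MDP.occ_eq_sum_ite {H : ℕ} (M : MDP H S A) (π : Policy H S A) (h : Fin H) (s : S)
    (a : A) :
    M.occ π h s a = ∑ τ, M.trajProb π τ * if τ h = (s, a) then 1 else 0 := by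
  simp [MDP.occ, sum_filter]

theorem MDP.value_eq_sum_occ {H : ℕ} (M : MDP H S A) (r : Fin H → S → A → ℝ)
    (π : Policy H S A) :
    M.value r π = ∑ h, ∑ s, ∑ a, r h s a * M.occ π h s a := by
  simp_rw [MDP.value, mul_sum]
  rw [sum_comm]
  refine sum_congr rfl fun h _ => ?_
  rw [M.sum_trajProb_mul π h fun x => r h x.1 x.2, Fintype.sum_prod_type]
  simp_rw [mul_comm]

theorem MDP.sum_occ {H : ℕ} (M : MDP H S A) (π : Policy H S A) (h : Fin H) :
    ∑ s, ∑ a, M.occ π h s a = 1 := by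
  obtain _ | n := H
  · exact h.elim0
  have := M.sum_trajProb_mul π h fun _ => 1
  simpa [M.sum_trajProb, Fintype.sum_prod_type] using this.symm

theorem MDP.occ_le_one {H : ℕ} (M : MDP H S A) (π : Policy H S A) (h : Fin H) (s : S) (a : A) :
    M.occ π h s a ≤ 1 := by
  rw [← M.sum_occ π h]
  exact (single_le_sum (f := fun a => M.occ π h s a) (fun _ _ => M.occ_nonneg _ _ _ _)
    (mem_univ a)).trans (single_le_sum (f := fun s => ∑ a, M.occ π h s a)
      (fun _ _ => sum_nonneg fun _ _ => M.occ_nonneg _ _ _ _) (mem_univ s))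

theorem MDP.occ_zero {n : ℕ} (M : MDP (n + 1) S A) (π : Policy (n + 1) S A) (s : S) (a : A) :
    M.occ π 0 s a = M.init.1 s * (π 0 s).1 a := by
  simp_rw [M.occ_eq_sum_ite, M.trajProb_eq_pathWeight]
  rw [sum_pathWeight_mul_zero _ _ (M.sum_kernel π) fun x => if x = (s, a) then 1 else 0]
  simp

/-- The Bellman flow equation. -/
theorem MDP.occ_succ {n : ℕ} (M : MDP (n + 1) S A) (π : Policy (n + 1) S A) (i : Fin n) (s : S)
    (a : A) :
    M.occ π i.succ s a = (∑ s', ∑ a', M.occ π i.castSucc s' a' *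
      (M.trans i.castSucc s' a').1 s) * (π i.succ s).1 a := by
  rw [M.occ_eq_sum_ite]
  simp_rw [M.trajProb_eq_pathWeight]
  rw [sum_pathWeight_mul_succ _ _ (M.sum_kernel π) i fun x => if x = (s, a) then 1 else 0]
  simp_rw [← M.trajProb_eq_pathWeight]
  rw [M.sum_trajProb_mul π i.castSucc
    fun x => ∑ y, M.kernel π i x y * if y = (s, a) then 1 else 0]
  simp only [mul_ite, mul_one, mul_zero, sum_ite_eq', mem_univ, if_true, MDP.kernel,
    Fintype.sum_prod_type, sum_mul, mul_assoc]

theorem MDP.sum_occ_zero {n : ℕ} (M : MDP (n + 1) S A) (π : Policy (n + 1) S A) (s : S) :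
    ∑ a, M.occ π 0 s a = M.init.1 s := by
  simp_rw [M.occ_zero, ← mul_sum, (π _ _).2.2, mul_one]

theorem MDP.sum_occ_succ {n : ℕ} (M : MDP (n + 1) S A) (π : Policy (n + 1) S A) (i : Fin n)
    (s : S) :
    ∑ a, M.occ π i.succ s a = ∑ s', ∑ a', M.occ π i.castSucc s' a' *
      (M.trans i.castSucc s' a').1 s := by
  simp_rw [M.occ_succ, ← mul_sum, (π _ _).2.2, mul_one]

/-- The conditional policy of the mean state-action distribution induces that distribution. -/
theorem MDP.occ_eq_meanOcc {H : ℕ} (M : MDP H S A) {T : ℕ} (hT : 0 < T)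
    (π : ℕ → Policy H S A) (out : Policy H S A)
    (hout : ∀ h s a, (∑ a' : A, M.meanOcc T π h s a') ≠ 0 →
      (out h s).1 a = M.meanOcc T π h s a / ∑ a' : A, M.meanOcc T π h s a')
    (h : Fin H) (s : S) (a : A) : M.occ out h s a = M.meanOcc T π h s a := by
  have hT' : (T : ℝ) ≠ 0 := by positivity
  -- Where the state marginal vanishes, so does each of its nonnegative summands; hence the
  -- factorization holds even where `out` is arbitrary.
  have key (h s a) : M.meanOcc T π h s a = (∑ a', M.meanOcc T π h s a') * (out h s).1 a := by
    by_cases h0 : ∑ a', M.meanOcc T π h s a' = 0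
    · rw [h0, zero_mul]
      refine (sum_eq_zero_iff_of_nonneg fun a _ => ?_).1 h0 a (mem_univ a)
      exact div_nonneg (sum_nonneg fun _ _ => M.occ_nonneg _ _ _ _) T.cast_nonneg
    · rw [hout h s a h0, mul_div_cancel₀ _ h0]
  obtain _ | n := H
  · exact h.elim0
  induction h using Fin.induction generalizing s a with
  | zero =>
    rw [key, M.occ_zero]
    congr 1
    simp_rw [MDP.meanOcc, ← sum_div]
    rw [sum_comm]
    simp_rw [M.sum_occ_zero]
    simp [hT']
  | succ i ih =>
    rw [key, M.occ_succ]
    -- With the factor of `out` cancelled, only state marginals remain; they are linear in the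
    -- previous occupancy, so averaging over `t` commutes with the flow.
    congr 1
    simp_rw [ih, MDP.meanOcc, ← sum_div]
    rw [sum_comm (s := univ (α := A))]
    simp_rw [M.sum_occ_succ, div_mul_eq_mul_div, ← sum_div, sum_mul]
    congr 1
    rw [sum_comm (s := Icc 1 T)]
    refine sum_congr rfl fun s' _ => ?_
    rw [sum_comm]

end Occupancy

/-! ### The empirical distribution. -/

section Empirical

variable {H N : ℕ} {S A : Type*} [DecidableEq S] [DecidableEq A]

theorem empOcc_nonneg (D : Fin N → Traj H S A) (h : Fin H) (s : S) (a : A) :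
    0 ≤ empOcc D h s a := by
  unfold empOcc
  positivity

theorem empOcc_le_one (D : Fin N → Traj H S A) (h : Fin H) (s : S) (a : A) :
    empOcc D h s a ≤ 1 := by
  refine div_le_one_of_le₀ ?_ N.cast_nonneg
  exact_mod_cast (card_le_univ _).trans_eq (Fintype.card_fin N)

theorem sum_empOcc [Fintype S] [Fintype A] (D : Fin N → Traj H S A) (hN : 0 < N) (h : Fin H) :
    ∑ s, ∑ a, empOcc D h s a = 1 := by
  have hc := card_eq_sum_card_fiberwise (s := (univ : Finset (Fin N))) (t := univ)
    (f := fun i => D i h) fun _ _ => mem_coe.2 (mem_univ _)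
  rw [card_univ, Fintype.card_fin, Fintype.sum_prod_type] at hc
  simp_rw [empOcc, ← sum_div]
  rw [div_eq_one_iff_eq (by positivity)]
  exact_mod_cast hc.symm

end Empirical

/-! ### Attainment of the minimal loss. -/

section Minimum

variable {H N : ℕ} {S A : Type*} [Fintype S] [Fintype A] [DecidableEq S] [DecidableEq A]

theorem MDP.continuous_occ (M : MDP H S A) (h : Fin H) (s : S) (a : A) :
    Continuous fun π : Policy H S A => M.occ π h s a := by
  unfold MDP.occ MDP.trajProb
  refine continuous_finsetSum _ fun τ _ => continuous_finsetProd _ fun k _ => ?_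
  refine continuous_const.mul ?_
  exact (continuous_apply _).comp
    (continuous_subtype_val.comp ((continuous_apply _).comp (continuous_apply k)))

/-- Policies form a compact product of simplices, and occupancies are polynomial in the policy, so
the loss is continuous. -/
theorem MDP.exists_isLeast_tvLoss [Nonempty (Policy H S A)] (M : MDP H S A)
    (D : Fin N → Traj H S A) : ∃ m, IsLeast (Set.range (M.tvLoss D)) m := by
  have : CompactSpace (stdSimplex ℝ A) := isCompact_iff_compactSpace.1 (isCompact_stdSimplex ℝ A)
  have hc : Continuous (M.tvLoss D) := by
    unfold MDP.tvLoss
    refine continuous_finsetSum _ fun h _ => continuous_finsetSum _ fun s _ =>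
      continuous_finsetSum _ fun a _ => ?_
    exact ((M.continuous_occ h s a).sub continuous_const).abs
  exact (isCompact_range hc).exists_isLeast (Set.range_nonempty _)

end Minimum

/-! ### Projected online gradient descent. -/

section GradientDescent

variable {E : Type*} [NormedAddCommGroup E] [InnerProductSpace ℝ E]

/-- By the variational inequality, `x - z` and `w - z` make no acute angle; expanding the square of
their difference gives the bound. -/
theorem IsProjection.norm_sub_sq_le {K : Set E} (hK : Convex ℝ K) {x z w : E}
    (hz : IsProjection K x z) (hw : w ∈ K) : ‖z - w‖ ^ 2 ≤ ‖x - w‖ ^ 2 := by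
  have hinf : ‖x - z‖ = ⨅ v : K, ‖x - v‖ := by
    have : Nonempty K := ⟨⟨w, hw⟩⟩
    refine le_antisymm (le_ciInf fun v => ?_)
      (ciInf_le ⟨0, by rintro _ ⟨v, rfl⟩; exact norm_nonneg _⟩ (⟨z, hz.1⟩ : K))
    rw [norm_sub_rev, norm_sub_rev x]
    exact hz.2 v v.2
  have h := (norm_eq_iInf_iff_real_inner_le_zero hK hz.1).1 hinf w hw
  have e : x - w = (x - z) - (w - z) := by abel
  rw [e, norm_sub_sq_real (x - z), norm_sub_rev z w]
  nlinarith [sq_nonneg ‖x - z‖]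

/-- The regret bound of projected online gradient descent with linear losses. -/
theorem sum_inner_sub_le_of_isProjection {K : Set E} (hK : Convex ℝ K) {z g : ℕ → E} {η : ℝ}
    (T : ℕ) (hz : ∀ t ∈ Icc 1 T, IsProjection K (z t - η • g t) (z (t + 1)))
    {w : E} (hw : w ∈ K) :
    2 * η * ∑ t ∈ Icc 1 T, inner ℝ (g t) (z t - w) ≤
      ‖z 1 - w‖ ^ 2 + η ^ 2 * ∑ t ∈ Icc 1 T, ‖g t‖ ^ 2 := by
  -- Keeping the final squared distance makes the sum telescope in the induction.
  suffices h : 2 * η * ∑ t ∈ Icc 1 T, inner ℝ (g t) (z t - w) + ‖z (T + 1) - w‖ ^ 2 ≤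
      ‖z 1 - w‖ ^ 2 + η ^ 2 * ∑ t ∈ Icc 1 T, ‖g t‖ ^ 2 by
    nlinarith [sq_nonneg ‖z (T + 1) - w‖]
  induction T with
  | zero => simp
  | succ T ih =>
    have ih := ih fun t ht => hz t (Icc_subset_Icc_right T.le_succ ht)
    have h := (hz (T + 1) (by simp)).norm_sub_sq_le hK hw
    have e : z (T + 1) - η • g (T + 1) - w = (z (T + 1) - w) - η • g (T + 1) := by abel
    rw [e, norm_sub_sq_real (z (T + 1) - w), norm_smul, mul_pow, Real.norm_eq_abs, sq_abs, inner_smul_right,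
      real_inner_comm] at h
    rw [sum_Icc_succ_top (by omega), sum_Icc_succ_top (by omega)]
    linarith

end GradientDescent

/-! ### The discriminator game: diameter, gradients and duality. -/

section Discriminators

variable {H N : ℕ} {S A : Type*} [Fintype S] [Fintype A]

theorem convex_discriminators : Convex ℝ (discriminators H S A) := by
  intro x hx y hy a b ha hb hab i
  exact convex_Icc (-1 : ℝ) 1 (hx i) (hy i) ha hb hab

theorem norm_sub_sq_le_of_mem_discriminators {c w : Cost H S A}
    (hc : c ∈ discriminators H S A) (hw : w ∈ discriminators H S A) :
    ‖c - w‖ ^ 2 ≤ 4 * (H * (Fintype.card S * Fintype.card A)) := by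
  rw [EuclideanSpace.real_norm_sq_eq]
  calc ∑ i, (c - w) i ^ 2 ≤ ∑ _i : Fin H × S × A, (4 : ℝ) := by
        refine sum_le_sum fun i _ => ?_
        rw [PiLp.sub_apply]
        obtain ⟨h1, h2⟩ := hc i
        obtain ⟨h3, h4⟩ := hw i
        nlinarith
    _ = _ := by simp [mul_comm]

variable [DecidableEq S] [DecidableEq A]

/-- The gradient of the discriminator objective. -/
noncomputable def MDP.discGrad (M : MDP H S A) (D : Fin N → Traj H S A) (π : Policy H S A) :
    Cost H S A :=
  WithLp.toLp 2 fun i => empOcc D i.1 i.2.1 i.2.2 - M.occ π i.1 i.2.1 i.2.2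

theorem MDP.discObj_eq_inner (M : MDP H S A) (D : Fin N → Traj H S A) (π : Policy H S A)
    (c : Cost H S A) : M.discObj D π c = inner ℝ (M.discGrad D π) c := by
  simp [MDP.discObj, MDP.discGrad, PiLp.inner_apply, Fintype.sum_prod_type]

theorem MDP.gradient_discObj (M : MDP H S A) (D : Fin N → Traj H S A) (π : Policy H S A)
    (c : Cost H S A) : gradient (M.discObj D π) c = M.discGrad D π := by
  refine HasGradientAt.gradient ?_
  rw [hasGradientAt_iff_hasFDerivAt]
  have e : M.discObj D π = InnerProductSpace.toDual ℝ (Cost H S A) (M.discGrad D π) := by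
    funext c
    rw [M.discObj_eq_inner, InnerProductSpace.toDual_apply_apply]
  rw [e]
  exact ContinuousLinearMap.hasFDerivAt _

/-- For `p, q` in `[0, 1]`, `(p - q)² ≤ p + q`, and both distributions have mass one at each step.
Thus `|S||A|` enters the regret only through the diameter. -/
theorem MDP.norm_discGrad_sq_le (M : MDP H S A) (D : Fin N → Traj H S A) (hN : 0 < N)
    (π : Policy H S A) : ‖M.discGrad D π‖ ^ 2 ≤ 2 * H := by
  rw [EuclideanSpace.real_norm_sq_eq]
  calc ∑ i, M.discGrad D π i ^ 2
      ≤ ∑ i : Fin H × S × A, (empOcc D i.1 i.2.1 i.2.2 + M.occ π i.1 i.2.1 i.2.2) := by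
        refine sum_le_sum fun i _ => ?_
        change (empOcc D i.1 i.2.1 i.2.2 - M.occ π i.1 i.2.1 i.2.2) ^ 2 ≤ _
        nlinarith [empOcc_nonneg D i.1 i.2.1 i.2.2, empOcc_le_one D i.1 i.2.1 i.2.2,
          M.occ_nonneg π i.1 i.2.1 i.2.2, M.occ_le_one π i.1 i.2.1 i.2.2]
    _ = 2 * H := by
        simp only [Fintype.sum_prod_type, sum_add_distrib, sum_empOcc D hN, M.sum_occ]
        simp [two_mul]

/-- This is the easy half of ℓ¹–ℓ∞ duality, coordinate by coordinate. -/
theorem MDP.neg_discObj_le_tvLoss (M : MDP H S A) (D : Fin N → Traj H S A) (π : Policy H S A)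
    {c : Cost H S A} (hc : c ∈ discriminators H S A) : -M.discObj D π c ≤ M.tvLoss D π := by
  simp only [MDP.discObj, MDP.tvLoss, ← sum_neg_distrib]
  refine sum_le_sum fun h _ => sum_le_sum fun s _ => sum_le_sum fun a _ => ?_
  rw [← mul_neg, neg_sub]
  refine (le_abs_self _).trans ?_
  rw [abs_mul]
  exact mul_le_of_le_one_left (abs_nonneg _) (abs_le.2 (hc _))

/-- An approximate best response to `-c` minimizes the total cost against any other policy. -/
theorem MDP.IsApproxOptimalPolicy.neg_discObj_le {M : MDP H S A} {δ : ℝ} {π : Policy H S A}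
    {c : Cost H S A} (hπ : M.IsApproxOptimalPolicy (fun h s a => -(c (h, s, a))) δ π)
    (D : Fin N → Traj H S A) (π' : Policy H S A) :
    -M.discObj D π c ≤ -M.discObj D π' c + δ := by
  have h := hπ π'
  simp only [M.value_eq_sum_occ, neg_mul, sum_neg_distrib] at h
  simp only [MDP.discObj, mul_sub, sum_sub_distrib]
  linarith

/-- The discriminator that realizes the distance to the mean state-action distribution. -/
theorem MDP.exists_discriminator_meanOcc (M : MDP H S A) (D : Fin N → Traj H S A) {T : ℕ}
    (hT : 0 < T) (π : ℕ → Policy H S A) :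
    ∃ w ∈ discriminators H S A, -∑ t ∈ Icc 1 T, M.discObj D (π t) w =
      T * ∑ h, ∑ s, ∑ a, |M.meanOcc T π h s a - empOcc D h s a| := by
  have hT' : (T : ℝ) ≠ 0 := by positivity
  refine ⟨WithLp.toLp 2 fun i =>
    SignType.sign (M.meanOcc T π i.1 i.2.1 i.2.2 - empOcc D i.1 i.2.1 i.2.2), fun i => ?_, ?_⟩
  · change (SignType.sign (M.meanOcc T π i.1 i.2.1 i.2.2 - empOcc D i.1 i.2.1 i.2.2) : ℝ) ∈ _
    cases SignType.sign (M.meanOcc T π i.1 i.2.1 i.2.2 - empOcc D i.1 i.2.1 i.2.2) <;> norm_num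
  · simp only [MDP.discObj]
    rw [sum_comm, mul_sum, ← sum_neg_distrib]
    refine sum_congr rfl fun h _ => ?_
    rw [sum_comm, mul_sum, ← sum_neg_distrib]
    refine sum_congr rfl fun s _ => ?_
    rw [sum_comm, mul_sum, ← sum_neg_distrib]
    refine sum_congr rfl fun a _ => ?_
    rw [← sign_mul_self, ← mul_sum, sum_sub_distrib]
    have e : ∑ t ∈ Icc 1 T, M.occ (π t) h s a = T * M.meanOcc T π h s a := by
      rw [MDP.meanOcc, mul_div_cancel₀ _ hT']
    rw [e]
    simp only [sum_const, Nat.card_Icc, Nat.add_sub_cancel, nsmul_eq_mul]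
    ring

end Discriminators

/-! ### Guarantee of a run and choice of constants. -/

section Run

variable {H N : ℕ} {S A : Type*} [Fintype S] [Fintype A] [DecidableEq S] [DecidableEq A]

theorem MDP.IsTVAILRun.mem_discriminators {M : MDP H S A} {D : Fin N → Traj H S A} {T : ℕ}
    {η : ℕ → ℝ} {δ : ℝ} {c : ℕ → Cost H S A} {π : ℕ → Policy H S A} {out : Policy H S A}
    (hrun : M.IsTVAILRun D T η δ c π out) {t : ℕ} (ht : t ∈ Icc 1 T) :
    c t ∈ discriminators H S A := by
  obtain ⟨h1, h2⟩ := mem_Icc.1 ht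
  obtain rfl | h := h1.eq_or_lt
  · exact hrun.init_mem
  · obtain ⟨k, rfl⟩ : ∃ k, t = k + 1 := ⟨t - 1, by omega⟩
    exact (hrun.disc_step k (mem_Icc.2 ⟨by omega, by omega⟩)).1

/-- The guarantee of a run with constant step size, before tuning the step size. -/
theorem MDP.IsTVAILRun.tvLoss_le {M : MDP H S A} {D : Fin N → Traj H S A} {T : ℕ} {η δ : ℝ}
    {c : ℕ → Cost H S A} {π : ℕ → Policy H S A} {out : Policy H S A}
    (hrun : M.IsTVAILRun D T (fun _ => η) δ c π out) (hN : 0 < N) (hT : 0 < T) (hη : 0 < η)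
    (π' : Policy H S A) :
    2 * η * (T * M.tvLoss D out) ≤ 2 * η * (T * (M.tvLoss D π' + δ)) +
      (4 * (H * (Fintype.card S * Fintype.card A)) + η ^ 2 * (T * (2 * H))) := by
  obtain ⟨w, hw, hw'⟩ := M.exists_discriminator_meanOcc D hT π
  have hreg := sum_inner_sub_le_of_isProjection convex_discriminators (g := fun t =>
    M.discGrad D (π t)) T (fun t ht => by
      simpa only [M.gradient_discObj] using hrun.disc_step t ht) hw
  simp only [inner_sub_right] at hreg
  simp only [← M.discObj_eq_inner, sum_sub_distrib] at hreg
  have hdiam := norm_sub_sq_le_of_mem_discriminators hrun.init_mem hw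
  have hgrad : ∑ t ∈ Icc 1 T, ‖M.discGrad D (π t)‖ ^ 2 ≤ T * (2 * H) := by
    refine (sum_le_card_nsmul _ _ _ fun t _ => M.norm_discGrad_sq_le D hN (π t)).trans_eq ?_
    simp
  have hbest : ∑ t ∈ Icc 1 T, -M.discObj D (π t) (c t) ≤ T * (M.tvLoss D π' + δ) := by
    refine (sum_le_card_nsmul _ _ (M.tvLoss D π' + δ) fun t ht => ?_).trans_eq ?_
    · have h1 := (hrun.policy_step t ht).neg_discObj_le D π'
      have h2 := M.neg_discObj_le_tvLoss D π' (hrun.mem_discriminators ht)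
      linarith
    · simp [mul_add]
  have hout : T * M.tvLoss D out = -∑ t ∈ Icc 1 T, M.discObj D (π t) w := by
    rw [hw', MDP.tvLoss]
    simp_rw [M.occ_eq_meanOcc hT π out hrun.output]
  rw [sum_neg_distrib] at hbest
  have hb := mul_le_mul_of_nonneg_left hbest (by positivity : 0 ≤ 2 * η)
  have hg := mul_le_mul_of_nonneg_left hgrad (sq_nonneg η)
  rw [hout]
  linarith

/-- Substituting `n = 8 * T * η ^ 2` turns the left side into `34 * H * T * η ^ 2`, so the claim
reduces to `34 * H * η ≤ ε`. Squared, this asks for `T ≥ (34 ^ 2 / 8) * n * H ^ 2 / ε ^ 2`, and `34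
^ 2 / 8 = 144.5 ≤ 145`. -/
theorem step_size_bound {n H T ε η : ℝ} (hn : 0 < n) (hH : 0 < H) (hε : 0 < ε) (hT : 0 < T)
    (hη : η = √(n / (8 * T))) (h : 145 * (n * H ^ 2 / ε ^ 2) ≤ T) :
    4 * (H * n) + η ^ 2 * (T * (2 * H)) ≤ 2 * η * (T * (ε / 2)) := by
  have hη0 : 0 < η := hη ▸ Real.sqrt_pos.2 (by positivity)
  have hsq : η ^ 2 * (8 * T) = n := by
    rw [hη, Real.sq_sqrt (by positivity), div_mul_cancel₀ _ (by positivity)]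
  have h' : 145 * (n * H ^ 2) ≤ T * ε ^ 2 := by
    rw [← mul_div_assoc, div_le_iff₀ (by positivity)] at h
    exact h
  have hle : 34 * (H * η) ≤ ε := by
    refine le_of_sq_le_sq ?_ hε.le
    rw [← hsq] at h'
    refine le_of_mul_le_mul_left ?_ hT
    nlinarith [show 0 ≤ T * (H * η) ^ 2 by positivity]
  rw [← hsq]
  nlinarith [mul_le_mul_of_nonneg_left hle (by positivity : 0 ≤ η * T)]

end Run

end TVAIL

theorem mainTheorem9 :
    ∃ C : ℝ, 0 < C ∧
      ∀ (S A : Type*) [Fintype S] [Fintype A] [DecidableEq S] [DecidableEq A]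
        (H N T : ℕ) (M : TVAIL.MDP H S A) (D : Fin N → TVAIL.Traj H S A) (ε εopt : ℝ)
        (c : ℕ → TVAIL.Cost H S A) (π : ℕ → TVAIL.Policy H S A) (out : TVAIL.Policy H S A),
        0 < N → 0 < ε → ε < (H : ℝ) → εopt ≤ ε / 2 →
        C * ((Fintype.card S : ℝ) * (Fintype.card A : ℝ) * (H : ℝ) ^ 2 / ε ^ 2) ≤ (T : ℝ) →
        M.IsTVAILRun D T
          (fun _ => √((Fintype.card S : ℝ) * (Fintype.card A : ℝ) / (8 * (T : ℝ)))) εopt c π out →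
        M.IsEpsOptimalTVAIL D ε out := by
  refine ⟨145, by norm_num, ?_⟩
  intro S A _ _ _ _ H N T M D ε εopt c π out hN hε hεH hopt hT hrun
  have hH : (0 : ℝ) < H := hε.trans hεH
  have hS : Nonempty S := by
    by_contra hS
    rw [not_nonempty_iff] at hS
    simpa using M.init.2.2
  have hA : Nonempty A := by
    by_contra hA
    rw [not_nonempty_iff] at hA
    simpa using (out ⟨0, by exact_mod_cast hH⟩ hS.some).2.2
  have hn : (0 : ℝ) < Fintype.card S * Fintype.card A := by positivity
  have hT0 : (0 : ℝ) < T := lt_of_lt_of_le (by positivity) hT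
  have : Nonempty (TVAIL.Policy H S A) := ⟨out⟩
  obtain ⟨m, ⟨π', rfl⟩, hm⟩ := M.exists_isLeast_tvLoss D
  refine ⟨_, ⟨⟨π', rfl⟩, hm⟩, ?_⟩
  set η := √((Fintype.card S : ℝ) * (Fintype.card A : ℝ) / (8 * (T : ℝ))) with hη
  have hη0 : 0 < η := Real.sqrt_pos.2 (by positivity)
  have h1 := hrun.tvLoss_le hN (by exact_mod_cast hT0) hη0 π'
  have h2 := TVAIL.step_size_bound hn hH hε hT0 hη hT
  -- Half of `ε` pays for the policy optimization error, the other half (`h2`) for the regret.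
  have h3 := mul_le_mul_of_nonneg_left hopt (by positivity : 0 ≤ 2 * η * (T : ℝ))
  refine le_of_mul_le_mul_left ?_ (by positivity : 0 < 2 * η * (T : ℝ))
  linarith
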